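/- For $k\in\mathbb N$ and positive integers $n_1,\ldots,n_k$ let $$W(n_1,\ldots,n_k)=\sum_{\substack{1\le a_i\le n_i,\ (a_i,n_i)=1\\ 1\le i\le k}} \operatorname{lcm}\bigl[(a_1-1,n_1),\ldots,(a_k-1,n_k)\bigr],$$ where $(a,b)$ denotes the greatest common divisor, with $(0,n)=n$, and let $\varphi$ be Euler's totient function. A function $f$ of $k$ positive integer variables is called multiplicative if $f(1,\ldots,1)=1$ and $f(m_1n_1,\ldots,m_kn_k)=f(m_1,\ldots,m_k)f(n_1,\ldots,n_k)$ whenever $(m_1\cdots m_k,\,n_1\cdots n_k)=1$. **Theorem.** For every $k$ there is a rational-valued function $h$ of $k$ positive integer variables, multiplicative and symmetric in its variables, such that for all positive integers $n_1,\ldots,n_k$ $$W(n_1,\ldots,n_k)=\varphi(n_1)\cdots\varphi(n_k)\,h(n_1,\ldots,n_k),$$ and such that for every prime $p$, every integer $0\le t\le k$ and all integers $\nu_1,\ldots,\nu_k$ with $\nu_1\ge\cdots\ge\nu_t\ge1$ and $\nu_{t+1}=\cdots=\nu_k=0$, $$h(p^{\nu_1},\ldots,p^{\nu_k})=1+(\nu_1+\cdots+\nu_t)+\sum_{j=1}^{t-1}\frac{(-1)^jp^j}{(p-1)^j(p^j-1)}\Biggl(\binom{t}{j+1}-\sum_{\substack{M\subseteq\{1,\ldots,t\}\\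 \#M=j+1}}\frac1{p^{\,j\nu_{\max M}}}\Biggr),$$ where $\max M$ is the largest element of $M$ and the sum over $j$ is empty if $t\le1$. -/

import Mathlib

namespace MenonLcm

/-- The sum `W(n₁,…,n_k)` of `lcm[(a₁ - 1, n₁), …, (a_k - 1, n_k)]` over all tuples with
`1 ≤ a_i ≤ n_i` and `(a_i, n_i) = 1`. Since `a_i ≥ 1`, the subtraction in `ℕ` is exact. -/
def W {k : ℕ} (n : Fin k → ℕ) : ℕ :=
  ∑ a ∈ Fintype.piFinset (fun i => (Finset.Icc 1 (n i)).filter (fun x => Nat.gcd x (n i) = 1)),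
    Finset.univ.lcm (fun i => Nat.gcd (a i - 1) (n i))

/-- Multiplicativity of an arithmetic function of `k` variables; only its values at tuples of
positive integers matter. -/
def IsMultiplicative {k : ℕ} (f : (Fin k → ℕ) → ℚ) : Prop :=
  f (fun _ => 1) = 1 ∧
    ∀ m n : Fin k → ℕ, (∀ i, 0 < m i) → (∀ i, 0 < n i) →
      Nat.gcd (∏ i, m i) (∏ i, n i) = 1 →
        f (fun i => m i * n i) = f m * f n

/-- Symmetry in the variables of an arithmetic function of `k` variables. -/
def IsSymmetric {k : ℕ} (f : (Fin k → ℕ) → ℚ) : Prop :=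
  ∀ (σ : Equiv.Perm (Fin k)) (n : Fin k → ℕ), (∀ i, 0 < n i) →
    f (fun i => n (σ i)) = f n

/-- `ν_{max M}`, the exponent at the largest index in `M`
(`M` is non-empty wherever this is used). -/
def expAtMax {k : ℕ} (ν : Fin k → ℕ) (M : Finset (Fin k)) : ℕ :=
  if hM : M.Nonempty then ν (M.max' hM) else 0

/-- The value claimed for `h(p^{ν₁},…,p^{ν_k})`. The index set `{1,…,t}` is the set of
the first `t` elements of `Fin k`. -/
def primePowerValue {k : ℕ} (p t : ℕ) (ν : Fin k → ℕ) : ℚ :=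
  let T : Finset (Fin k) := Finset.univ.filter (fun i => (i : ℕ) < t)
  1 + ∑ i ∈ T, (ν i : ℚ) +
    ∑ j ∈ Finset.Ico 1 t,
      ((-1 : ℚ) ^ j * (p : ℚ) ^ j) / (((p : ℚ) - 1) ^ j * ((p : ℚ) ^ j - 1)) *
        ((Nat.choose t (j + 1) : ℚ) -
          ∑ M ∈ Finset.powersetCard (j + 1) T, 1 / (p : ℚ) ^ (j * expAtMax ν M))

end MenonLcm

namespace MenonLcm

/-! Take `h = W / ∏ φ(n_i)`. With `b = a - 1` the sum runs over residues, so the Chinese remainder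
theorem gives multiplicativity (`W_mul`). At powers of `p` the lcm `L` is a power of `p`, and `L = 1
+ ∑ (p^(m+1) - p^m) [p^(m+1) ∣ L]` telescopes. The event `p^(m+1) ∤ L` is a conjunction of
independent conditions on the `b_i`, so its average is a product (`W_prime_pow`). Expanding over
subsets `M` and summing over `m < ν_{max M}` gives geometric series (`primePowerValue_eq`). -/

/-! ### Multiplicativity and symmetry -/

/-- The residues `b < n` such that `b + 1` is coprime to `n`. -/
def shiftedUnits (n : ℕ) : Finset ℕ :=
  (Finset.range n).filter (fun b => Nat.gcd (b + 1) n = 1)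

theorem mem_shiftedUnits {n b : ℕ} :
    b ∈ shiftedUnits n ↔ b < n ∧ Nat.gcd (b + 1) n = 1 := by
  simp [shiftedUnits]

theorem card_shiftedUnits (n : ℕ) : (shiftedUnits n).card = n.totient := by
  rw [← Nat.filter_coprime_Ico_eq_totient n 1]
  refine Finset.card_nbij' (fun b => b + 1) (fun a => a - 1) ?_ ?_ ?_ ?_
  · intro b hb
    simp only [Finset.mem_coe, mem_shiftedUnits, Finset.mem_filter, Finset.mem_Ico] at hb ⊢
    exact ⟨by omega, Nat.Coprime.symm hb.2⟩
  · intro a ha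
    simp only [Finset.mem_coe, mem_shiftedUnits, Finset.mem_filter, Finset.mem_Ico] at ha ⊢
    rw [Nat.sub_add_cancel ha.1.1]
    exact ⟨by omega, Nat.Coprime.symm ha.2⟩
  · intro b _
    rfl
  · intro a ha
    simp only [Finset.mem_coe, Finset.mem_filter, Finset.mem_Ico] at ha
    exact Nat.sub_add_cancel ha.1.1

theorem W_eq_sum_shiftedUnits {k : ℕ} (n : Fin k → ℕ) :
    W n = ∑ b ∈ Fintype.piFinset (fun i => shiftedUnits (n i)),
      Finset.univ.lcm (fun i => Nat.gcd (b i) (n i)) := by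
  unfold W
  refine Finset.sum_nbij' (fun a i => a i - 1) (fun b i => b i + 1) ?_ ?_ ?_ ?_ ?_
  · intro a ha
    simp only [Fintype.mem_piFinset, Finset.mem_filter, Finset.mem_Icc, mem_shiftedUnits] at ha ⊢
    intro i
    obtain ⟨⟨h1, h2⟩, h3⟩ := ha i
    rw [Nat.sub_add_cancel h1]
    exact ⟨by omega, h3⟩
  · intro b hb
    simp only [Fintype.mem_piFinset, Finset.mem_filter, Finset.mem_Icc, mem_shiftedUnits] at hb ⊢
    intro i
    exact ⟨⟨by omega, (hb i).1⟩, (hb i).2⟩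
  · intro a ha
    simp only [Fintype.mem_piFinset, Finset.mem_filter, Finset.mem_Icc] at ha
    funext i
    exact Nat.sub_add_cancel (ha i).1.1
  · intro b _
    rfl
  · intro a _
    rfl

/-- Coprimality is needed across different indices too, since the two lcms must be coprime. -/
theorem lcm_mul_of_coprime {ι : Type*} (s : Finset ι) (d e : ι → ℕ)
    (h : ∀ i ∈ s, ∀ j ∈ s, Nat.Coprime (d i) (e j)) :
    s.lcm (fun i => d i * e i) = s.lcm d * s.lcm e := by
  apply Nat.dvd_antisymm
  · exact Finset.lcm_dvd fun i hi => mul_dvd_mul (Finset.dvd_lcm hi) (Finset.dvd_lcm hi)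
  · have hc : Nat.Coprime (s.lcm d) (s.lcm e) := by
      have hd : ∀ j ∈ s, Nat.Coprime (∏ i ∈ s, d i) (e j) := fun j hj =>
        Nat.Coprime.prod_left fun i hi => h i hi j hj
      have hde : Nat.Coprime (∏ i ∈ s, d i) (∏ j ∈ s, e j) := Nat.Coprime.prod_right hd
      exact Nat.Coprime.of_dvd (Finset.lcm_dvd fun i hi => Finset.dvd_prod_of_mem d hi)
        (Finset.lcm_dvd fun i hi => Finset.dvd_prod_of_mem e hi) hde
    refine hc.mul_dvd_of_dvd_of_dvd ?_ ?_
    · exact Finset.lcm_dvd fun i hi => (dvd_mul_right _ _).trans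
        (Finset.dvd_lcm (f := fun i => d i * e i) hi)
    · exact Finset.lcm_dvd fun i hi => (dvd_mul_left _ _).trans
        (Finset.dvd_lcm (f := fun i => d i * e i) hi)

theorem gcd_mod_add_one (b m : ℕ) : Nat.gcd (b % m + 1) m = Nat.gcd (b + 1) m :=
  ((Nat.mod_modEq b m).add_right 1).gcd_eq

theorem W_mul {k : ℕ} (m n : Fin k → ℕ) (hm : ∀ i, 0 < m i) (hn : ∀ i, 0 < n i)
    (h : ∀ i j, Nat.Coprime (m i) (n j)) :
    W (fun i => m i * n i) = W m * W n := by
  simp only [W_eq_sum_shiftedUnits]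
  rw [Finset.sum_mul_sum, ← Finset.sum_product']
  refine Finset.sum_bij (fun b _ => (fun i => b i % m i, fun i => b i % n i)) ?_ ?_ ?_ ?_
  · intro b hb
    simp only [Fintype.mem_piFinset, Finset.mem_product, mem_shiftedUnits] at hb ⊢
    refine ⟨fun i => ⟨Nat.mod_lt _ (hm i), ?_⟩, fun i => ⟨Nat.mod_lt _ (hn i), ?_⟩⟩
    · rw [gcd_mod_add_one]
      exact Nat.Coprime.coprime_mul_right_right (hb i).2
    · rw [gcd_mod_add_one]
      exact Nat.Coprime.coprime_mul_left_right (hb i).2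
  · intro b hb c hc hbc
    simp only [Fintype.mem_piFinset, mem_shiftedUnits, Prod.mk.injEq] at hb hc hbc
    funext i
    have h1 : b i ≡ c i [MOD m i * n i] :=
      (Nat.modEq_and_modEq_iff_modEq_mul (h i i)).1
        ⟨congrFun hbc.1 i, congrFun hbc.2 i⟩
    exact Nat.ModEq.eq_of_lt_of_lt h1 (hb i).1 (hc i).1
  · rintro ⟨x, y⟩ hxy
    simp only [Fintype.mem_piFinset, Finset.mem_product, mem_shiftedUnits] at hxy
    have hx : ∀ i, (Nat.chineseRemainder (h i i) (x i) (y i) : ℕ) % m i = x i := fun i =>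
      Eq.trans (Nat.chineseRemainder (h i i) (x i) (y i)).2.1 (Nat.mod_eq_of_lt (hxy.1 i).1)
    have hy : ∀ i, (Nat.chineseRemainder (h i i) (x i) (y i) : ℕ) % n i = y i := fun i =>
      Eq.trans (Nat.chineseRemainder (h i i) (x i) (y i)).2.2 (Nat.mod_eq_of_lt (hxy.2 i).1)
    refine ⟨fun i => Nat.chineseRemainder (h i i) (x i) (y i), ?_, ?_⟩
    · simp only [Fintype.mem_piFinset, mem_shiftedUnits]
      intro i
      refine ⟨Nat.chineseRemainder_lt_mul _ _ _ (hm i).ne' (hn i).ne', ?_⟩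
      refine Nat.Coprime.mul_right ?_ ?_
      · rw [Nat.Coprime, ← gcd_mod_add_one, hx]
        exact (hxy.1 i).2
      · rw [Nat.Coprime, ← gcd_mod_add_one, hy]
        exact (hxy.2 i).2
    · simp only [hx, hy]
  · intro b _
    rw [← lcm_mul_of_coprime]
    · refine Finset.lcm_congr rfl fun i _ => ?_
      rw [(h i i).gcd_mul, (Nat.mod_modEq (b i) (m i)).gcd_eq, (Nat.mod_modEq (b i) (n i)).gcd_eq]
    · intro i _ j _
      exact Nat.Coprime.of_dvd (Nat.gcd_dvd_right _ _) (Nat.gcd_dvd_right _ _) (h i j)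

theorem W_comp_perm {k : ℕ} (σ : Equiv.Perm (Fin k)) (n : Fin k → ℕ) :
    W (fun i => n (σ i)) = W n := by
  unfold W
  refine Finset.sum_nbij' (fun a i => a (σ.symm i)) (fun a i => a (σ i)) ?_ ?_ ?_ ?_ ?_
  · intro a ha
    simp only [Fintype.mem_piFinset] at ha ⊢
    intro i
    simpa using ha (σ.symm i)
  · intro a ha
    simp only [Fintype.mem_piFinset] at ha ⊢
    intro i
    exact ha (σ i)
  · intro a _
    simp
  · intro a _
    simp
  · intro a _
    apply Nat.dvd_antisymm
    · refine Finset.lcm_dvd fun i _ => ?_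
      simpa using Finset.dvd_lcm (f := fun i => Nat.gcd (a (σ.symm i) - 1) (n i))
        (Finset.mem_univ (σ i))
    · refine Finset.lcm_dvd fun i _ => ?_
      simpa using Finset.dvd_lcm (f := fun i => Nat.gcd (a i - 1) (n (σ i)))
        (Finset.mem_univ (σ.symm i))

/-! ### Averages at prime powers -/

/-- Each `f i` is a power of `p`; if none reaches exponent `m + 1`, all divide `p ^ m`, hence so
does the lcm. -/
theorem prime_pow_dvd_lcm_iff {ι : Type*} (s : Finset ι) {p : ℕ} (hp : p.Prime)
    (f ν : ι → ℕ) (hf : ∀ i ∈ s, f i ∣ p ^ ν i) (m : ℕ) :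
    p ^ (m + 1) ∣ s.lcm f ↔ ∃ i ∈ s, p ^ (m + 1) ∣ f i := by
  refine ⟨fun h => ?_, fun ⟨i, hi, h⟩ => h.trans (Finset.dvd_lcm hi)⟩
  by_contra! hn
  have hm : s.lcm f ∣ p ^ m := by
    refine Finset.lcm_dvd fun i hi => ?_
    obtain ⟨e, -, he⟩ := (Nat.dvd_prime_pow hp).1 (hf i hi)
    have hlt : e < m + 1 := by
      by_contra! hle
      exact hn i hi (he ▸ pow_dvd_pow p hle)
    rw [he]
    exact pow_dvd_pow p (by omega)
  have := (Nat.pow_dvd_pow_iff_le_right hp.one_lt).1 (h.trans hm)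
  omega

theorem sum_range_ite_lt {e N : ℕ} (he : e ≤ N) (f : ℕ → ℚ) :
    ∑ m ∈ Finset.range N, (if m < e then f m else 0) = ∑ m ∈ Finset.range e, f m := by
  rw [← Finset.sum_filter]
  congr 1
  ext m
  simp only [Finset.mem_filter, Finset.mem_range]
  omega

theorem eq_one_add_sum_of_dvd_prime_pow {p : ℕ} (hp : p.Prime) {L N : ℕ} (hL : L ∣ p ^ N) :
    (L : ℚ) = 1 + ∑ m ∈ Finset.range N,
      if p ^ (m + 1) ∣ L then (p : ℚ) ^ (m + 1) - (p : ℚ) ^ m else 0 := by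
  obtain ⟨e, he, rfl⟩ := (Nat.dvd_prime_pow hp).1 hL
  simp only [Nat.pow_dvd_pow_iff_le_right hp.one_lt, Nat.add_one_le_iff]
  rw [sum_range_ite_lt he, Finset.sum_range_sub]
  simp

/-- A multiple `b` of `p ^ (m + 1)` has `b + 1 ≡ 1` mod `p`, so the unit condition is automatic and
only multiples are counted. -/
theorem card_filter_dvd_shiftedUnits {p : ℕ} (hp : p.Prime) (ν m : ℕ) (hm : m < ν) :
    ((shiftedUnits (p ^ ν)).filter (fun b => p ^ (m + 1) ∣ Nat.gcd b (p ^ ν))).card =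
      p ^ (ν - (m + 1)) := by
  have hpos : 0 < p ^ (m + 1) := pow_pos hp.pos _
  have hpow : p ^ ν = p ^ (ν - (m + 1)) * p ^ (m + 1) := by
    rw [← pow_add]
    congr 1
    omega
  have key : (shiftedUnits (p ^ ν)).filter (fun b => p ^ (m + 1) ∣ Nat.gcd b (p ^ ν)) =
      (Finset.range (p ^ (ν - (m + 1)))).image (· * p ^ (m + 1)) := by
    ext b
    simp only [Finset.mem_filter, mem_shiftedUnits, Finset.mem_image, Finset.mem_range]
    constructor
    · rintro ⟨⟨hb, -⟩, hd⟩
      obtain ⟨c, rfl⟩ := hd.trans (Nat.gcd_dvd_left _ _)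
      refine ⟨c, ?_, mul_comm _ _⟩
      rw [hpow, mul_comm] at hb
      exact Nat.lt_of_mul_lt_mul_right hb
    · rintro ⟨c, hc, rfl⟩
      refine ⟨⟨?_, ?_⟩, Nat.dvd_gcd (dvd_mul_left _ _) (pow_dvd_pow p hm)⟩
      · rw [hpow]
        exact Nat.mul_lt_mul_of_pos_right hc hpos
      · refine Nat.Coprime.pow_right ν ?_
        refine ((Nat.Prime.coprime_iff_not_dvd hp).2 fun h => ?_).symm
        have h1 : p ∣ c * p ^ (m + 1) :=
          (dvd_pow_self p (Nat.succ_ne_zero m)).trans (dvd_mul_left _ _)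
        exact hp.one_lt.ne' (Nat.dvd_one.1 ((Nat.dvd_add_right h1).1 h))
  rw [key, Finset.card_image_of_injective, Finset.card_range]
  exact fun a b hab => Nat.eq_of_mul_eq_mul_right hpos hab

theorem sum_shiftedUnits_indicator {p : ℕ} (hp : p.Prime) (ν m : ℕ) :
    ∑ b ∈ shiftedUnits (p ^ ν),
      (1 - if p ^ (m + 1) ∣ Nat.gcd b (p ^ ν) then (1 : ℚ) else 0) =
    (Nat.totient (p ^ ν) : ℚ) *
      (1 - if m < ν then 1 / ((p : ℚ) ^ (m + 1) - (p : ℚ) ^ m) else 0) := by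
  rw [Finset.sum_sub_distrib, Finset.sum_const, card_shiftedUnits, Finset.sum_boole, mul_sub]
  simp only [nsmul_eq_mul, mul_one]
  congr 1
  split_ifs with hm
  · rw [card_filter_dvd_shiftedUnits hp ν m hm, Nat.totient_prime_pow hp (by omega)]
    obtain ⟨d, rfl⟩ := Nat.exists_eq_add_of_lt hm
    have hp0 : (p : ℚ) ≠ 0 := Nat.cast_ne_zero.2 hp.ne_zero
    have hp1 : (p : ℚ) - 1 ≠ 0 := sub_ne_zero.2 (Nat.cast_ne_one.2 hp.ne_one)
    have h1 : (p : ℚ) ^ (m + 1) - (p : ℚ) ^ m = (p : ℚ) ^ m * (p - 1) := by ring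
    rw [h1, Nat.cast_mul, Nat.cast_sub hp.one_le,
      show m + d + 1 - (m + 1) = d by omega, show m + d + 1 - 1 = m + d by omega]
    push_cast
    field_simp
    ring
  · rw [mul_zero, Nat.cast_eq_zero, Finset.card_eq_zero, Finset.filter_eq_empty_iff]
    intro b _ hd
    have := (Nat.pow_dvd_pow_iff_le_right hp.one_lt).1 (hd.trans (Nat.gcd_dvd_right _ _))
    omega

theorem W_prime_pow {k p N : ℕ} (hp : p.Prime) (ν : Fin k → ℕ) (hN : ∀ i, ν i ≤ N) :
    (W (fun i => p ^ ν i) : ℚ) = (∏ i, (Nat.totient (p ^ ν i) : ℚ)) *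
      (1 + ∑ m ∈ Finset.range N, ((p : ℚ) ^ (m + 1) - (p : ℚ) ^ m) *
        (1 - ∏ i, (1 - if m < ν i then 1 / ((p : ℚ) ^ (m + 1) - (p : ℚ) ^ m) else 0))) := by
  have hterm : ∀ b : Fin k → ℕ,
      ((Finset.univ.lcm (fun i => Nat.gcd (b i) (p ^ ν i)) : ℕ) : ℚ) =
      1 + ∑ m ∈ Finset.range N, ((p : ℚ) ^ (m + 1) - (p : ℚ) ^ m) *
        (1 - ∏ i, (1 - if p ^ (m + 1) ∣ Nat.gcd (b i) (p ^ ν i) then (1 : ℚ) else 0)) := by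
    intro b
    rw [eq_one_add_sum_of_dvd_prime_pow hp (N := N) (Finset.lcm_dvd fun i _ =>
      (Nat.gcd_dvd_right _ _).trans (pow_dvd_pow p (hN i)))]
    congr 1
    refine Finset.sum_congr rfl fun m _ => ?_
    simp only [prime_pow_dvd_lcm_iff _ hp _ ν (fun i _ => Nat.gcd_dvd_right (b i) (p ^ ν i))]
    split_ifs with h
    · obtain ⟨i, hi, hd⟩ := h
      rw [Finset.prod_eq_zero hi]
      · ring
      · simp [hd]
    · push Not at h
      rw [Finset.prod_eq_one]
      · ring
      · intro i hi
        rw [if_neg (h i hi), sub_zero]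
  have hcard : ∑ b ∈ Fintype.piFinset (fun i => shiftedUnits (p ^ ν i)), (1 : ℚ) =
      ∏ i, (Nat.totient (p ^ ν i) : ℚ) := by
    simp [Fintype.card_piFinset, card_shiftedUnits]
  rw [W_eq_sum_shiftedUnits]
  push_cast
  rw [Finset.sum_congr rfl fun b _ => hterm b, Finset.sum_add_distrib, hcard, Finset.sum_comm,
    mul_add, mul_one, Finset.mul_sum]
  congr 1
  refine Finset.sum_congr rfl fun m _ => ?_
  rw [← Finset.mul_sum, Finset.sum_sub_distrib, hcard, ← Finset.prod_univ_sum
    (fun i => shiftedUnits (p ^ ν i))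
    (fun i b => 1 - if p ^ (m + 1) ∣ Nat.gcd b (p ^ ν i) then (1 : ℚ) else 0)]
  simp only [sum_shiftedUnits_indicator hp]
  rw [Finset.prod_mul_distrib]
  ring

/-! ### The closed formula -/

theorem sum_range_geometric {p : ℕ} (hp : p.Prime) {j : ℕ} (hj : 1 ≤ j) (e : ℕ) :
    ∑ m ∈ Finset.range e, (-(1 / ((p : ℚ) ^ (m + 1) - (p : ℚ) ^ m))) ^ j =
      ((-1 : ℚ) ^ j * (p : ℚ) ^ j) / (((p : ℚ) - 1) ^ j * ((p : ℚ) ^ j - 1)) *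
        (1 - 1 / (p : ℚ) ^ (j * e)) := by
  have hp0 : (p : ℚ) ≠ 0 := Nat.cast_ne_zero.2 hp.ne_zero
  have hp1 : (p : ℚ) - 1 ≠ 0 := sub_ne_zero.2 (Nat.cast_ne_one.2 hp.ne_one)
  have hpj : (p : ℚ) ^ j - 1 ≠ 0 :=
    sub_ne_zero.2 (one_lt_pow₀ (Nat.one_lt_cast.2 hp.one_lt) (by omega)).ne'
  induction e with
  | zero => simp
  | succ e ih =>
    have h1 : (p : ℚ) ^ (e + 1) - (p : ℚ) ^ e = (p : ℚ) ^ e * (p - 1) := by ring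
    rw [Finset.sum_range_succ, ih, h1, neg_eq_neg_one_mul (1 / _), mul_pow (-1 : ℚ), div_pow,
      one_pow, mul_pow ((p : ℚ) ^ e), ← pow_mul, mul_comm e j, Nat.mul_succ, pow_add]
    field_simp
    ring

/-- On `M` the exponent is smallest at `max M`, so that index alone decides whether every factor
survives. -/
theorem prod_indicator_of_antitone {k t : ℕ} (ν : Fin k → ℕ)
    (hν : ∀ i j : Fin k, i ≤ j → (j : ℕ) < t → ν j ≤ ν i) (m : ℕ) (x : ℚ)
    {M : Finset (Fin k)} (hM : M.Nonempty) (hMt : ∀ i ∈ M, (i : ℕ) < t) :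
    ∏ i ∈ M, (-if m < ν i then x else 0) = if m < expAtMax ν M then (-x) ^ M.card else 0 := by
  rw [expAtMax, dif_pos hM]
  have hmax := M.max'_mem hM
  split_ifs with h
  · rw [← Finset.prod_const]
    refine Finset.prod_congr rfl fun i hi => ?_
    rw [if_pos (h.trans_le (hν i _ (M.le_max' i hi) (hMt _ hmax)))]
  · exact Finset.prod_eq_zero hmax (by rw [if_neg h, neg_zero])

theorem primePowerValue_eq {k p t N : ℕ} (hp : p.Prime) (ht : t ≤ k) (ν : Fin k → ℕ)
    (hN : ∀ i, ν i ≤ N)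
    (hν : ∀ i j : Fin k, i ≤ j → (j : ℕ) < t → ν j ≤ ν i)
    (hν0 : ∀ i : Fin k, t ≤ (i : ℕ) → ν i = 0) :
    1 + ∑ m ∈ Finset.range N, ((p : ℚ) ^ (m + 1) - (p : ℚ) ^ m) *
        (1 - ∏ i, (1 - if m < ν i then 1 / ((p : ℚ) ^ (m + 1) - (p : ℚ) ^ m) else 0)) =
      primePowerValue p t ν := by
  unfold primePowerValue
  set T : Finset (Fin k) := Finset.univ.filter (fun i => (i : ℕ) < t) with hT
  have hTcard : T.card = t := by
    rw [hT, Fin.card_filter_val_lt, min_eq_right ht]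
  have hmemT : ∀ i, i ∈ T ↔ (i : ℕ) < t := fun i => by simp [hT]
  have hp0 : (p : ℚ) ≠ 0 := Nat.cast_ne_zero.2 hp.ne_zero
  have hp1 : (p : ℚ) - 1 ≠ 0 := sub_ne_zero.2 (Nat.cast_ne_one.2 hp.ne_one)
  have hexp : ∀ M : Finset (Fin k), expAtMax ν M ≤ N := by
    intro M
    unfold expAtMax
    split_ifs
    · exact hN _
    · exact Nat.zero_le _
  have hm : ∀ m, ((p : ℚ) ^ (m + 1) - (p : ℚ) ^ m) *
      (1 - ∏ i, (1 - if m < ν i then 1 / ((p : ℚ) ^ (m + 1) - (p : ℚ) ^ m) else 0)) =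
      ∑ j ∈ Finset.range t, ∑ M ∈ Finset.powersetCard (j + 1) T,
        if m < expAtMax ν M then (-(1 / ((p : ℚ) ^ (m + 1) - (p : ℚ) ^ m))) ^ j else 0 := by
    intro m
    have hq : (p : ℚ) ^ (m + 1) - (p : ℚ) ^ m ≠ 0 := by
      rw [show (p : ℚ) ^ (m + 1) - (p : ℚ) ^ m = (p : ℚ) ^ m * (p - 1) by ring]
      exact mul_ne_zero (pow_ne_zero _ hp0) hp1
    set q := (p : ℚ) ^ (m + 1) - (p : ℚ) ^ m
    have hprod : ∏ i, (1 - if m < ν i then 1 / q else 0) =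
        ∏ i ∈ T, (1 + -if m < ν i then 1 / q else 0) := by
      simp only [← sub_eq_add_neg]
      refine (Finset.prod_subset (Finset.subset_univ T) fun i _ hi => ?_).symm
      rw [hmemT, not_lt] at hi
      simp [hν0 i hi]
    -- The empty subset cancels the leading 1, so `j` indexes subsets of size `j + 1`.
    rw [hprod, Finset.prod_one_add, Finset.sum_powerset, hTcard, Finset.sum_range_succ',
      Finset.powersetCard_zero, Finset.sum_singleton, Finset.prod_empty, sub_add_cancel_right,
      mul_neg, Finset.mul_sum, ← Finset.sum_neg_distrib]
    refine Finset.sum_congr rfl fun j _ => ?_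
    rw [Finset.mul_sum, ← Finset.sum_neg_distrib]
    refine Finset.sum_congr rfl fun M hM => ?_
    rw [Finset.mem_powersetCard] at hM
    rw [prod_indicator_of_antitone ν hν m (1 / q) (Finset.card_pos.1 (by omega))
      fun i hi => (hmemT i).1 (hM.1 hi), hM.2]
    split_ifs
    -- The weight `q` cancels one of the `j + 1` factors `-1/q`.
    · rw [pow_succ]
      field_simp
    · simp
  have hj : ∀ j, ∑ m ∈ Finset.range N, ∑ M ∈ Finset.powersetCard (j + 1) T,
        (if m < expAtMax ν M then (-(1 / ((p : ℚ) ^ (m + 1) - (p : ℚ) ^ m))) ^ j else 0) =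
      ∑ M ∈ Finset.powersetCard (j + 1) T, ∑ m ∈ Finset.range (expAtMax ν M),
        (-(1 / ((p : ℚ) ^ (m + 1) - (p : ℚ) ^ m))) ^ j := by
    intro j
    rw [Finset.sum_comm]
    exact Finset.sum_congr rfl fun M _ => sum_range_ite_lt (hexp M) _
  have hzero : ∑ M ∈ Finset.powersetCard (0 + 1) T, ∑ m ∈ Finset.range (expAtMax ν M),
        (-(1 / ((p : ℚ) ^ (m + 1) - (p : ℚ) ^ m))) ^ 0 = ∑ i ∈ T, (ν i : ℚ) := by
    rw [zero_add, Finset.powersetCard_one, Finset.sum_map]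
    refine Finset.sum_congr rfl fun i _ => ?_
    simp [expAtMax]
  simp only [hm]
  rw [Finset.sum_comm, Finset.sum_congr rfl fun j _ => hj j, add_assoc]
  congr 1
  rcases Nat.eq_zero_or_pos t with h0 | hpos
  · have hT0 : T = ∅ := Finset.card_eq_zero.1 (hTcard.trans h0)
    simp [h0, hT0]
  -- The term `j = 0` is split off, as `p ^ j - 1` vanishes there; singletons contribute `∑ ν i`.
  · rw [Finset.range_eq_Ico, Finset.sum_eq_sum_Ico_succ_bot hpos, hzero]
    congr 1
    refine Finset.sum_congr rfl fun j hj1 => ?_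
    rw [Finset.mem_Ico] at hj1
    rw [Finset.sum_congr rfl fun M _ => sum_range_geometric hp hj1.1 (expAtMax ν M),
      ← Finset.mul_sum, Finset.sum_sub_distrib, Finset.sum_const, Finset.card_powersetCard,
      hTcard, nsmul_eq_mul, mul_one]

end MenonLcm

theorem theorem4p1 (k : ℕ) :
    ∃ h : (Fin k → ℕ) → ℚ,
      (∀ n : Fin k → ℕ, (∀ i, 0 < n i) →
        (MenonLcm.W n : ℚ) = (∏ i, (Nat.totient (n i) : ℚ)) * h n) ∧
      MenonLcm.IsMultiplicative h ∧
      MenonLcm.IsSymmetric h ∧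
      ∀ (p : ℕ), p.Prime → ∀ (t : ℕ), t ≤ k → ∀ ν : Fin k → ℕ,
        (∀ i j : Fin k, i ≤ j → (j : ℕ) < t → ν j ≤ ν i) →
        (∀ i : Fin k, (i : ℕ) < t → 1 ≤ ν i) →
        (∀ i : Fin k, t ≤ (i : ℕ) → ν i = 0) →
          h (fun i => p ^ ν i) = MenonLcm.primePowerValue p t ν := by
  have hφ : ∀ n : Fin k → ℕ, (∀ i, 0 < n i) → ∏ i, (Nat.totient (n i) : ℚ) ≠ 0 := fun n hn =>
    Finset.prod_ne_zero_iff.2 fun i _ => Nat.cast_ne_zero.2 (Nat.totient_pos.2 (hn i)).ne'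
  refine ⟨fun n => (MenonLcm.W n : ℚ) / ∏ i, (Nat.totient (n i) : ℚ), ?_, ⟨?_, ?_⟩, ?_, ?_⟩
  · intro n hn
    exact (mul_div_cancel₀ _ (hφ n hn)).symm
  · have h1 : MenonLcm.W (fun _ : Fin k => 1) = 1 := by
      have hA : MenonLcm.shiftedUnits 1 = {0} := rfl
      have hlcm : Finset.univ.lcm (fun _ : Fin k => 1) = 1 :=
        Nat.dvd_one.1 (Finset.lcm_dvd fun _ _ => dvd_rfl)
      simp [MenonLcm.W_eq_sum_shiftedUnits, hA, hlcm]
    simp [h1]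
  · intro m n hm hn h
    have hc : ∀ i j, Nat.Coprime (m i) (n j) := fun i j =>
      Nat.Coprime.of_dvd (Finset.dvd_prod_of_mem m (Finset.mem_univ i))
        (Finset.dvd_prod_of_mem n (Finset.mem_univ j)) h
    have hφmul : ∏ i, (Nat.totient (m i * n i) : ℚ) =
        (∏ i, (Nat.totient (m i) : ℚ)) * ∏ i, (Nat.totient (n i) : ℚ) := by
      rw [← Finset.prod_mul_distrib]
      refine Finset.prod_congr rfl fun i _ => ?_
      rw [Nat.totient_mul (hc i i), Nat.cast_mul]
    simp only [MenonLcm.W_mul m n hm hn hc, hφmul, Nat.cast_mul]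
    exact mul_div_mul_comm _ _ _ _
  · intro σ n _
    simp only [MenonLcm.W_comp_perm σ n]
    rw [Equiv.prod_comp σ fun i => (Nat.totient (n i) : ℚ)]
  · intro p hp t ht ν hν _ hν0
    -- Any common bound on the exponents serves as the cutoff `N`.
    have hN : ∀ i, ν i ≤ ∑ i, ν i := fun i =>
      Finset.single_le_sum (fun _ _ => Nat.zero_le _) (Finset.mem_univ i)
    simp only [MenonLcm.W_prime_pow hp ν hN]
    rw [mul_div_cancel_left₀ _ (hφ _ fun i => pow_pos hp.pos _)]
    exact MenonLcm.primePowerValue_eq hp ht ν hN hν hν0
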